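/- Let $K$ be a field, let $S=K[x_1,\dots,x_n]$ be the standard graded polynomial ring with $\mathfrak m=(x_1,\dots,x_n)$ and graded components $S_d$, and let $I\subset S$ be a graded ideal with $0\neq I\neq S$. For an ideal $J\subset S$ let $\mathrm{Ass}(J)$ be the set of associated primes of $S/J$. For a graded ideal $J\subsetneq S$ and $\mathfrak p\in\mathrm{Ass}(J)$ put $$v_{\mathfrak p}(J)=\min\{d:\ (J:f)=\mathfrak p\text{ for some }f\in S_d\},\qquad v(J)=\min\{d:\ (J:f)\in\mathrm{Ass}(J)\text{ for some }f\in S_d\}.$$ For a finitely generated graded $S$-module $M=\bigoplus_{d\ge 0}M_d\neq0$ put $\alpha(M)=\min\{d: M_d\ne0\}$ and $\omega(M)=\max\{d:(M/\mathfrak mM)_d\neq0\}$. Let $\mathrm{Ass}^\infty(I)$ be the set of primes $\mathfrak p$ with $\mathfrak p\in\mathrm{Ass}(I^k)$ for all $k\gg0$. Then the function $k\mapsto v(I^k)$ is strictly increasing for $k\gg0$. Moreover, for every $\mathfrak p\in\mathrm{Ass}^\infty(I)$: 1. the function $k\mapsto v_{\mathfrak p}(I^k)$ is strictly increasing for $k\gg0$;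 2. $\omega((I^k:\mathfrak p)/I^k)\ \ge\ \alpha((I^{k-1}:\mathfrak p)/I^{k-1})+\alpha(I)$ for all $k\gg0$; 3. $\alpha((I^k:\mathfrak p)/I^k)\ \le\ \omega((I^{k-1}:\mathfrak p)/I^{k-1})+\omega(I)$ for all $k\gg0$. -/

import Mathlib

open MvPolynomial Filter

attribute [local instance] MvPolynomial.gradedAlgebra

noncomputable section

namespace VNumber

variable {K : Type*} [Field K] {n : ℕ}

section GradedModules

variable {M : Type*} [AddCommGroup M] [Module K M]

/-- The initial degree `α(M) = min {d : M_d ≠ 0}` of a graded module with graded pieces `ℳ d`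
(used for `M ≠ 0`). -/
def initialDegree (ℳ : ℕ → Submodule K M) : ℕ :=
  sInf {d | ℳ d ≠ ⊥}

/-- `ω(M) = max {d : (M / 𝔪 M)_d ≠ 0}`, where `𝔪 = (x₁, …, xₙ)`, for a finitely generated graded
module `M ≠ 0` over `K[x₁, …, xₙ]` with graded pieces `ℳ d`; the piece `(M / 𝔪 M)_d` is the image
of `ℳ d` in `M / 𝔪 M`. -/
def topGeneratorDegree [Module (MvPolynomial (Fin n) K) M]
    [IsScalarTower K (MvPolynomial (Fin n) K) M] (ℳ : ℕ → Submodule K M) : ℕ :=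
  sSup {d | (ℳ d).map
    ((Submodule.mkQ ((Ideal.span (Set.range X) : Ideal (MvPolynomial (Fin n) K)) •
      (⊤ : Submodule (MvPolynomial (Fin n) K) M))).restrictScalars K) ≠ ⊥}

end GradedModules

/-- The graded pieces `I_d = I ∩ S_d` of an ideal, regarded as a graded `S`-module. -/
def idealPiece (I : Ideal (MvPolynomial (Fin n) K)) (d : ℕ) : Submodule K I :=
  (homogeneousSubmodule (Fin n) K d).comap (I.subtype.restrictScalars K)

/-- The `S`-module `(J : 𝔭) / J`; note that `J ≤ (J : 𝔭)`. -/
abbrev ColonQuotient (J p : Ideal (MvPolynomial (Fin n) K)) : Type _ :=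
  ↥(J.colon (p : Set (MvPolynomial (Fin n) K))) ⧸
    J.submoduleOf (J.colon (p : Set (MvPolynomial (Fin n) K)))

/-- The graded pieces of `(J : 𝔭) / J`: the residue classes of the elements of `(J : 𝔭)_d`. -/
def colonQuotientPiece (J p : Ideal (MvPolynomial (Fin n) K)) (d : ℕ) :
    Submodule K (ColonQuotient J p) :=
  (idealPiece (J.colon (p : Set (MvPolynomial (Fin n) K))) d).map
    ((J.submoduleOf (J.colon (p : Set (MvPolynomial (Fin n) K)))).mkQ.restrictScalars K)

/-- `α(I)`. -/
def alphaIdeal (I : Ideal (MvPolynomial (Fin n) K)) : ℕ :=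
  initialDegree (idealPiece I)

/-- `ω(I)`. -/
def omegaIdeal (I : Ideal (MvPolynomial (Fin n) K)) : ℕ :=
  topGeneratorDegree (n := n) (idealPiece I)

/-- `α((J : 𝔭) / J)`. -/
def alphaColon (J p : Ideal (MvPolynomial (Fin n) K)) : ℕ :=
  initialDegree (colonQuotientPiece J p)

/-- `ω((J : 𝔭) / J)`. -/
def omegaColon (J p : Ideal (MvPolynomial (Fin n) K)) : ℕ :=
  topGeneratorDegree (n := n) (colonQuotientPiece J p)

/-- The v-number of `J` at `𝔭`: the least `d` for which some `f ∈ S_d` has `(J : f) = 𝔭`. -/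
def vNumberAt (p J : Ideal (MvPolynomial (Fin n) K)) : ℕ :=
  sInf {d | ∃ f ∈ homogeneousSubmodule (Fin n) K d, J.colon {f} = p}

/-- The v-number of `J`: the least `d` for which some `f ∈ S_d` has `(J : f) ∈ Ass(J)`. -/
def vNumber (J : Ideal (MvPolynomial (Fin n) K)) : ℕ :=
  sInf {d | ∃ f ∈ homogeneousSubmodule (Fin n) K d, J.colon {f} ∈ J.associatedPrimes}

/-- `Ass^∞(I)`: the primes that belong to `Ass(I^k)` for all large `k`. -/
def stablePrimes (I : Ideal (MvPolynomial (Fin n) K)) : Set (Ideal (MvPolynomial (Fin n) K)) :=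
  {p | ∀ᶠ k : ℕ in atTop, p ∈ (I ^ k).associatedPrimes}

end VNumber

end

/-! Everything rests on the identity `(I^(k+1) : p) = I * (I^k : p)` for `p ≠ 0` and large `k`
(`exists_colon_pow_succ_eq`), a consequence of Artin–Rees. A homogeneous `f` with `(I^(k+1) : f) =
p` is then a sum of products `g * h` with `g ∈ I` and `h ∈ (I^k : p)` homogeneous. If every `h` were
pushed into `I^k` by a multiplier outside `p`, then `f` would be pushed into `I^(k+1)` by one too,
which is impossible. So some `h` has `(I^k : h) = p`, and its degree is smaller because `g` has
positive degree (`exists_lt_colon_eq`). For `v(I^k)` the identity must hold for all associated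
primes at once, so only finitely many primes may occur (`exists_finite_associatedPrimes_pow`, half
of Brodmann's theorem). The `α`/`ω` inequalities come from comparing degrees in the same
factorization. -/

namespace Ideal

open Polynomial

variable {R : Type*} [CommRing R]

/-! ### Artin–Rees and colon ideals of powers. -/

/-- The filtration `k ↦ (I ^ k : p)`. -/
def colonFiltration (I p : Ideal R) : I.Filtration R where
  N k := (I ^ k).colon (p : Set R)
  mono k := Submodule.colon_mono (Ideal.pow_le_pow_right k.le_succ) subset_rfl
  smul_le k := by
    rw [smul_eq_mul, Ideal.mul_le]
    intro a ha b hb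
    rw [Submodule.mem_colon] at hb ⊢
    intro x hx
    rw [smul_eq_mul, mul_assoc, pow_succ']
    exact Ideal.mul_mem_mul ha (hb x hx)

/-- The filtration `k ↦ I ^ (k - c)`, with truncated subtraction. -/
def shiftedFiltration (I : Ideal R) (c : ℕ) : I.Filtration R where
  N k := I ^ (k - c)
  mono k := Ideal.pow_le_pow_right (by omega)
  smul_le k := by
    rw [smul_eq_mul, ← pow_succ']
    exact Ideal.pow_le_pow_right (by omega)

theorem shiftedFiltration_stable (I : Ideal R) (c : ℕ) : (I.shiftedFiltration c).Stable := by
  refine ⟨c, fun k hk => ?_⟩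
  change I • I ^ (k - c) = I ^ (k + 1 - c)
  rw [smul_eq_mul, ← pow_succ', Nat.succ_sub hk]

/-- For a nonzero `x ∈ p`, Artin–Rees puts `f * x ∈ I^k ∩ (x)` into `I^(k-c) * (x)`; cancel `x`. -/
theorem exists_colon_le_pow_sub [IsNoetherianRing R] [IsDomain R] (I p : Ideal R) (hp : p ≠ ⊥) :
    ∃ c, ∀ k, (I ^ k).colon (p : Set R) ≤ I ^ (k - c) := by
  obtain ⟨x, hx, hx0⟩ := Submodule.exists_mem_ne_zero_of_ne_bot hp
  obtain ⟨c, hc⟩ := Ideal.exists_pow_inf_eq_pow_smul (M := R) I (Ideal.span {x})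
  refine ⟨c, fun k f hf => ?_⟩
  rcases lt_or_ge k c with h | h
  · simp [Nat.sub_eq_zero_of_le h.le]
  have h1 : f * x ∈ I ^ k • (⊤ : Ideal R) ⊓ Ideal.span {x} := by
    refine ⟨?_, Ideal.mul_mem_left _ _ (Ideal.mem_span_singleton_self x)⟩
    simpa using Submodule.mem_colon.1 hf x hx
  rw [hc k h] at h1
  have h2 : f * x ∈ I ^ (k - c) * Ideal.span {x} :=
    Submodule.smul_mono le_rfl inf_le_right h1
  obtain ⟨y, hy, hyx⟩ := Ideal.mem_mul_span_singleton.1 h2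
  rwa [← mul_right_cancel₀ hx0 hyx]

/-- Over a Noetherian ring, a filtration contained in a stable filtration of a finite module is
stable. -/
theorem exists_colon_pow_succ_eq [IsNoetherianRing R] [IsDomain R] (I p : Ideal R) (hp : p ≠ ⊥) :
    ∃ k₀, ∀ k ≥ k₀,
      (I ^ (k + 1)).colon (p : Set R) = I * (I ^ k).colon (p : Set R) := by
  obtain ⟨c, hc⟩ := exists_colon_le_pow_sub I p hp
  obtain ⟨k₀, h⟩ := (I.shiftedFiltration_stable c).of_le (F' := I.colonFiltration p) hc
  exact ⟨k₀, fun k hk => (h k hk).symm⟩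

theorem exists_colon_pow_succ_self_le [IsNoetherianRing R] [IsDomain R] (I : Ideal R)
    (hI : I ≠ ⊥) : ∃ k₀, ∀ k ≥ k₀, (I ^ (k + 1)).colon (I : Set R) ≤ I ^ k := by
  obtain ⟨k₀, h⟩ := exists_colon_pow_succ_eq I I hI
  refine ⟨k₀, fun k hk => ?_⟩
  rw [h k hk, Ideal.mul_le]
  intro a ha b hb
  rw [mul_comm]
  exact Submodule.mem_colon.1 hb a ha

/-! ### Finiteness of the associated primes of large powers. -/

/-- The extension of `I` to its Rees algebra; the quotient is the associated graded ring. -/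
def reesExtension (I : Ideal R) : Ideal (reesAlgebra I) where
  carrier := {a | ∀ i, (a : R[X]).coeff i ∈ I ^ (i + 1)}
  add_mem' ha hb i := by
    simpa using Ideal.add_mem _ (ha i) (hb i)
  zero_mem' i := by simp
  smul_mem' a b hb i := by
    simp only [smul_eq_mul, MulMemClass.coe_mul, Polynomial.coeff_mul]
    refine Ideal.sum_mem _ fun x hx => ?_
    rw [← Finset.HasAntidiagonal.mem_antidiagonal.1 hx, add_assoc, pow_add]
    exact Ideal.mul_mem_mul (a.2 _) (hb _)

/-- A prime contracted from `ann x` is contracted from a minimal prime of `ann x`, and such a prime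
is associated to the cyclic module generated by `x`. -/
theorem exists_associatedPrimes_comap_eq {R S M : Type*} [CommRing R] [CommRing S]
    [IsNoetherianRing S] [AddCommGroup M] [Module S M] (f : R →+* S) (x : M)
    (hp : (((⊥ : Submodule S M).colon {x}).comap f).IsPrime) :
    ∃ P ∈ associatedPrimes S M, P.comap f = ((⊥ : Submodule S M).colon {x}).comap f := by
  obtain ⟨P, hP, h⟩ := Ideal.exists_minimalPrimes_comap_eq
    (I := (⊥ : Submodule S M).colon {x}) f (((⊥ : Submodule S M).colon {x}).comap f) (by
      rw [Ideal.minimalPrimes_eq_subsingleton_self]; exact Set.mem_singleton _)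
  refine ⟨P, ?_, h⟩
  have h1 : Module.annihilator S (Submodule.span S {x}) = (⊥ : Submodule S M).colon {x} := by
    rw [Submodule.bot_colon']
  have h2 := Module.associatedPrimes.minimalPrimes_annihilator_subset_associatedPrimes
    S (Submodule.span S {x}) (by rw [h1]; exact hP)
  exact associatedPrimes.subset_of_injective (f := (Submodule.span S {x}).subtype)
    (Submodule.subtype_injective _) h2

theorem exists_associatedPrimes_quotient_comap_eq {R S : Type*} [CommRing R] [CommRing S]
    [IsNoetherianRing S] (J : Ideal S) (f : R →+* S) (x : S)
    (hp : ((J.colon {x}).comap f).IsPrime) :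
    ∃ P ∈ associatedPrimes S (S ⧸ J), P.comap f = (J.colon {x}).comap f := by
  have h : (⊥ : Submodule S (S ⧸ J)).colon {Submodule.Quotient.mk x} = J.colon {x} := by
    ext r
    rw [Submodule.mem_colon_singleton, Submodule.mem_colon_singleton, Submodule.mem_bot,
      ← Submodule.Quotient.mk_smul, Submodule.Quotient.mk_eq_zero]
  rw [← h] at hp ⊢
  exact exists_associatedPrimes_comap_eq f _ hp

/-- Each such prime is contracted from one of the finitely many associated primes of the associated
graded ring. -/
theorem exists_finite_associatedPrimes_pow [IsNoetherianRing R] [IsDomain R] (I : Ideal R)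
    (hI : I ≠ ⊥) : ∃ s : Set (Ideal R), s.Finite ∧
      ∃ k₀, ∀ k ≥ k₀, (I ^ k).associatedPrimes ⊆ s := by
  obtain ⟨k₀, hk₀⟩ := exists_colon_pow_succ_self_le I hI
  refine ⟨(fun P => P.comap (algebraMap R (reesAlgebra I))) ''
    associatedPrimes (reesAlgebra I) (reesAlgebra I ⧸ I.reesExtension),
    (associatedPrimes.finite _ _).image _, k₀ + 1, fun k hk p hp => ?_⟩
  obtain ⟨k, rfl⟩ : ∃ j, k = j + 1 := ⟨k - 1, by omega⟩
  obtain ⟨hp, f, rfl⟩ := Submodule.isAssociatedPrime_iff.1 hp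
  have hle : I ≤ (I ^ (k + 1)).colon {f} :=
    hp.le_of_pow_le (n := k + 1) Ideal.le_colon
  -- Since `I` lies in the prime `(I^(k+1) : f)`, `f` lies in `(I^(k+1) : I)`; so `f` defines a
  -- class in degree `k` of the associated graded ring.
  have hf : f ∈ I ^ k := by
    refine hk₀ k (by omega) (Submodule.mem_colon.2 fun s hs => ?_)
    rw [smul_eq_mul, mul_comm]
    exact Submodule.mem_colon_singleton.1 (hle hs)
  let F : reesAlgebra I := ⟨monomial k f, reesAlgebra.monomial_mem.2 hf⟩
  have key : (I.reesExtension.colon {F}).comap (algebraMap R (reesAlgebra I)) =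
      (I ^ (k + 1)).colon {f} := by
    ext r
    rw [Ideal.mem_comap, Submodule.mem_colon_singleton, Submodule.mem_colon_singleton]
    have : ((algebraMap R (reesAlgebra I) r • F : reesAlgebra I) : R[X]) =
        monomial k (r * f) := by
      change Polynomial.C r * Polynomial.monomial k f = _
      rw [Polynomial.C_mul_monomial]
    change (∀ i, Polynomial.coeff ((algebraMap R (reesAlgebra I) r • F : reesAlgebra I) : R[X]) i ∈
      I ^ (i + 1)) ↔ r * f ∈ I ^ (k + 1)
    rw [this]
    simp only [Polynomial.coeff_monomial]
    constructor
    · intro h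
      simpa using h k
    · intro h i
      split_ifs with hi
      · exact hi ▸ h
      · exact Ideal.zero_mem _
  obtain ⟨P, hP, h⟩ := exists_associatedPrimes_quotient_comap_eq I.reesExtension
    (algebraMap R (reesAlgebra I)) F (key ▸ hp)
  exact ⟨P, hP, h.trans key⟩

end Ideal

namespace VNumber

variable {K : Type*} [Field K] {n : ℕ}

local notation "S" => MvPolynomial (Fin n) K

/-! ### Homogeneous components, colon ideals and associated primes. -/

theorem homogeneousComponent_mul (d : ℕ) (f g : S) :
    homogeneousComponent d (f * g) = ∑ x ∈ Finset.HasAntidiagonal.antidiagonal d,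
      homogeneousComponent x.1 f * homogeneousComponent x.2 g := by
  have h : ∀ (i : ℕ) (f : S), (DirectSum.decompose (homogeneousSubmodule (Fin n) K) f i : S) =
    homogeneousComponent i f := fun i f => decomposition.decompose'_apply f i
  rw [← h, DirectSum.decompose_mul, DirectSum.coe_mul_apply_eq_sum_antidiagonal]
  simp only [h]

theorem mem_of_homogeneousComponent_mem (T : AddSubmonoid S) {f : S}
    (h : ∀ i, homogeneousComponent i f ∈ T) : f ∈ T := by
  rw [← sum_homogeneousComponent f]
  exact T.sum_mem fun i _ => h i

/-- `T` is only an additive submonoid so that `saturation` can be used as well as ideals. -/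
theorem homogeneousComponent_mem_of_mem_mul {P Q : Ideal S}
    (hP : P.IsHomogeneous (homogeneousSubmodule (Fin n) K))
    (hQ : Q.IsHomogeneous (homogeneousSubmodule (Fin n) K)) (T : AddSubmonoid S) (d : ℕ)
    (hT : ∀ i j, i + j = d → ∀ g ∈ P, g.IsHomogeneous i → ∀ h ∈ Q, h.IsHomogeneous j → g * h ∈ T)
    {f : S} (hf : f ∈ P * Q) : homogeneousComponent d f ∈ T := by
  induction hf using Submodule.mul_induction_on' with
  | mem_mul_mem g hg h hh =>
    rw [homogeneousComponent_mul]
    exact T.sum_mem fun x hx => hT _ _ (Finset.HasAntidiagonal.mem_antidiagonal.1 hx)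
      _ (homogeneousComponent_mem_of_mem hP hg _) (homogeneousComponent_isHomogeneous _ _)
      _ (homogeneousComponent_mem_of_mem hQ hh _) (homogeneousComponent_isHomogeneous _ _)
  | add x _ y _ hx hy =>
    rw [map_add]
    exact T.add_mem hx hy

theorem mem_of_mem_mul_of_isHomogeneous {P Q : Ideal S}
    (hP : P.IsHomogeneous (homogeneousSubmodule (Fin n) K))
    (hQ : Q.IsHomogeneous (homogeneousSubmodule (Fin n) K)) (T : AddSubmonoid S) {d : ℕ}
    (hT : ∀ i j, i + j = d → ∀ g ∈ P, g.IsHomogeneous i → ∀ h ∈ Q, h.IsHomogeneous j → g * h ∈ T)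
    {f : S} (hf : f ∈ P * Q) (hd : f.IsHomogeneous d) : f ∈ T := by
  rw [← homogeneousComponent_eq_self hd]
  exact homogeneousComponent_mem_of_mem_mul hP hQ T d hT hf

theorem isHomogeneous_of_homogeneousComponent_mem {J : Ideal S}
    (h : ∀ f ∈ J, ∀ i, homogeneousComponent i f ∈ J) :
    J.IsHomogeneous (homogeneousSubmodule (Fin n) K) := by
  intro i f hf
  have := decomposition.decompose'_apply f i
  change (DirectSum.decompose (homogeneousSubmodule (Fin n) K) f i : S) = _ at this
  rw [this]
  exact h f hf i

theorem isHomogeneous_pow {I : Ideal S}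
    (hI : I.IsHomogeneous (homogeneousSubmodule (Fin n) K)) (k : ℕ) :
    (I ^ k).IsHomogeneous (homogeneousSubmodule (Fin n) K) := by
  induction k with
  | zero => simpa using Ideal.IsHomogeneous.top _
  | succ k ih => rw [pow_succ]; exact ih.mul hI

theorem homogeneousComponent_mul_of_isHomogeneous {g : S} {a : ℕ} (hg : g.IsHomogeneous a)
    (f : S) (j : ℕ) : homogeneousComponent (a + j) (g * f) = g * homogeneousComponent j f := by
  rw [homogeneousComponent_mul, Finset.sum_eq_single (a, j)]
  · rw [homogeneousComponent_eq_self hg]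
  · intro x hx hne
    have hx := Finset.HasAntidiagonal.mem_antidiagonal.1 hx
    rw [homogeneousComponent_of_mem ((mem_homogeneousSubmodule _ _).2 hg), if_neg, zero_mul]
    intro h
    exact hne (Prod.ext h (by dsimp only; omega))
  · intro h
    exact (h (Finset.HasAntidiagonal.mem_antidiagonal.2 rfl)).elim

theorem homogeneousComponent_mul_of_lt {g : S} {a : ℕ} (hg : g.IsHomogeneous a)
    (f : S) {d : ℕ} (hd : d < a) : homogeneousComponent d (g * f) = 0 := by
  rw [homogeneousComponent_mul]
  refine Finset.sum_eq_zero fun x hx => ?_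
  have hx := Finset.HasAntidiagonal.mem_antidiagonal.1 hx
  rw [homogeneousComponent_of_mem ((mem_homogeneousSubmodule _ _).2 hg), if_neg (by omega),
    zero_mul]

theorem isHomogeneous_colon {J p : Ideal S}
    (hJ : J.IsHomogeneous (homogeneousSubmodule (Fin n) K))
    (hp : p.IsHomogeneous (homogeneousSubmodule (Fin n) K)) :
    (J.colon (p : Set S)).IsHomogeneous (homogeneousSubmodule (Fin n) K) := by
  refine isHomogeneous_of_homogeneousComponent_mem fun f hf i => ?_
  refine Submodule.mem_colon.2 fun x hx => ?_
  have h : x ∈ (J.colon {homogeneousComponent i f}).toAddSubmonoid := by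
    refine mem_of_homogeneousComponent_mem _ fun j => ?_
    have h1 := homogeneousComponent_mem_of_mem hJ
      (Submodule.mem_colon.1 hf _ (homogeneousComponent_mem_of_mem hp hx j)) (j + i)
    rw [smul_eq_mul, mul_comm,
      homogeneousComponent_mul_of_isHomogeneous (homogeneousComponent_isHomogeneous j x)] at h1
    exact Submodule.mem_colon_singleton.2 h1
  rw [smul_eq_mul, mul_comm]
  exact Submodule.mem_colon_singleton.1 h

/-- The components of `f` lie in the window `[c, c + b)`. The product of the top components of `r`
and `f` is in `J`, so `f` may be replaced by `r_a * (f - top)`, whose window is shorter by one. -/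
theorem exists_pow_homogeneousComponent_mul_mem {J : Ideal S}
    (hJ : J.IsHomogeneous (homogeneousSubmodule (Fin n) K)) {r : S} {a : ℕ}
    (ha : ∀ i, a < i → homogeneousComponent i r = 0) (b : ℕ) (c : ℕ) (f : S)
    (hc : ∀ i, i < c → homogeneousComponent i f = 0)
    (hb : ∀ i, c + b ≤ i → homogeneousComponent i f = 0) (h : r * f ∈ J) :
    ∃ m, homogeneousComponent a r ^ m * f ∈ J := by
  induction b generalizing f c with
  | zero =>
    refine ⟨0, ?_⟩
    have : f ∈ J.toAddSubmonoid := mem_of_homogeneousComponent_mem _ fun i => by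
      rcases lt_or_ge i c with h | h
      · rw [hc i h]; exact J.zero_mem
      · rw [hb i h]; exact J.zero_mem
    simpa using this
  | succ b ih =>
    have hr := homogeneousComponent_isHomogeneous a r
    have h1 : homogeneousComponent a r * homogeneousComponent (c + b) f ∈ J := by
      have h2 := homogeneousComponent_mem_of_mem hJ h (a + (c + b))
      rwa [homogeneousComponent_mul, Finset.sum_eq_single (a, c + b)] at h2
      · intro x hx hne
        have hx := Finset.HasAntidiagonal.mem_antidiagonal.1 hx
        rcases lt_or_ge a x.1 with h3 | h3
        · rw [ha _ h3, zero_mul]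
        · rw [hb x.2, mul_zero]
          by_contra h4
          exact hne (Prod.ext (by dsimp only; omega) (by dsimp only; omega))
      · intro h
        exact (h (Finset.HasAntidiagonal.mem_antidiagonal.2 rfl)).elim
    have hsub : ∀ i, (i < c ∨ c + b ≤ i) →
        homogeneousComponent i (f - homogeneousComponent (c + b) f) = 0 := by
      intro i hi
      rw [map_sub, homogeneousComponent_of_mem (homogeneousComponent_mem (c + b) f)]
      split_ifs with h
      · rw [h, sub_self]
      · rw [sub_zero]
        rcases hi with hi | hi
        · exact hc i hi
        · exact hb i (by omega)
    obtain ⟨m, hm⟩ := ih (a + c) (homogeneousComponent a r * (f - homogeneousComponent (c + b) f))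
      (fun i hi => by
        rcases lt_or_ge i a with h | h
        · exact homogeneousComponent_mul_of_lt hr _ h
        · obtain ⟨j, rfl⟩ := Nat.exists_eq_add_of_le h
          rw [homogeneousComponent_mul_of_isHomogeneous hr, hsub j (by omega), mul_zero])
      (fun i hi => by
        obtain ⟨j, rfl⟩ := Nat.exists_eq_add_of_le (show a ≤ i by omega)
        rw [homogeneousComponent_mul_of_isHomogeneous hr, hsub j (by omega), mul_zero])
      (by
        convert! J.sub_mem (J.mul_mem_left (homogeneousComponent a r) h)
          (J.mul_mem_left r h1) using 1
        ring)
    refine ⟨m + 1, ?_⟩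
    convert! J.add_mem hm (J.mul_mem_left (homogeneousComponent a r ^ m) h1) using 1
    ring

/-- Primality turns a power of the top component of `r ∈ p` lying in `p` into the component itself;
subtract it and repeat. -/
theorem isHomogeneous_of_mem_associatedPrimes {J p : Ideal S}
    (hJ : J.IsHomogeneous (homogeneousSubmodule (Fin n) K)) (hp : p ∈ J.associatedPrimes) :
    p.IsHomogeneous (homogeneousSubmodule (Fin n) K) := by
  obtain ⟨hp, f, rfl⟩ := Submodule.isAssociatedPrime_iff.1 hp
  suffices h : ∀ a : ℕ, ∀ r ∈ J.colon {f}, (∀ i, a ≤ i → homogeneousComponent i r = 0) →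
      ∀ i, homogeneousComponent i r ∈ J.colon {f} from
    isHomogeneous_of_homogeneousComponent_mem fun r hr => h (r.totalDegree + 1) r hr
      fun i hi => homogeneousComponent_eq_zero _ _ (by omega)
  intro a
  induction a with
  | zero =>
    intro r _ h i
    rw [h i i.zero_le]
    exact Submodule.zero_mem _
  | succ a ih =>
    intro r hr h i
    have hra : homogeneousComponent a r ∈ J.colon {f} := by
      obtain ⟨m, hm⟩ := exists_pow_homogeneousComponent_mul_mem hJ (r := r) (a := a)
        (fun i hi => h i hi) (f.totalDegree + 1) 0 f (fun i hi => absurd hi i.not_lt_zero)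
        (fun i hi => homogeneousComponent_eq_zero _ _ (by omega))
        (Submodule.mem_colon_singleton.1 hr)
      exact hp.mem_of_pow_mem m (Submodule.mem_colon_singleton.2 hm)
    by_cases hi : i = a
    · rwa [hi]
    have h2 := ih (r - homogeneousComponent a r) (sub_mem hr hra) (fun j hj => by
      rw [map_sub, homogeneousComponent_of_mem (homogeneousComponent_mem a r)]
      split_ifs with h'
      · rw [h', sub_self]
      · rw [sub_zero, h j (by omega)]) i
    rwa [map_sub, homogeneousComponent_of_mem (homogeneousComponent_mem a r), if_neg hi,
      sub_zero] at h2

/-! ### Descent of v-numbers from one power to the previous one. -/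

/-- The additive submonoid of elements that a multiplier outside the prime `p` sends into `J`. -/
def saturation (J p : Ideal S) (hp : p.IsPrime) : AddSubmonoid S where
  carrier := {x | ∃ a ∉ p, a * x ∈ J}
  zero_mem' := ⟨1, fun h => hp.ne_top ((Ideal.eq_top_iff_one _).2 h), by simp⟩
  add_mem' := by
    rintro x y ⟨a, ha, hax⟩ ⟨b, hb, hby⟩
    refine ⟨a * b, fun h => (hp.mem_or_mem h).elim ha hb, ?_⟩
    convert! J.add_mem (J.mul_mem_left b hax) (J.mul_mem_left a hby) using 1
    ring

theorem notMem_saturation {J p : Ideal S} (hp : p.IsPrime) {f : S} (h : J.colon {f} = p) :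
    f ∉ saturation J p hp := by
  rintro ⟨a, ha, haf⟩
  exact ha (h ▸ Submodule.mem_colon_singleton.2 haf)

theorem mem_saturation_of_colon_ne {J p : Ideal S} (hp : p.IsPrime) {f : S}
    (hf : f ∈ J.colon (p : Set S)) (h : J.colon {f} ≠ p) : f ∈ saturation J p hp := by
  by_contra hf'
  refine h (le_antisymm (fun a ha => ?_) fun a ha => ?_)
  · by_contra hap
    exact hf' ⟨a, hap, Submodule.mem_colon_singleton.1 ha⟩
  · rw [Submodule.mem_colon_singleton, smul_eq_mul, mul_comm]
    exact Submodule.mem_colon.1 hf a ha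

theorem mem_colon_of_colon_singleton_eq {J p : Ideal S} {f : S} (h : J.colon {f} = p) :
    f ∈ J.colon (p : Set S) := by
  refine Submodule.mem_colon.2 fun a ha => ?_
  rw [smul_eq_mul, mul_comm]
  exact Submodule.mem_colon_singleton.1 (h ▸ ha : a ∈ J.colon {f})

/-- If no component of a witness `f` were a witness, all of them, hence `f`, would lie in the
saturation. -/
theorem exists_isHomogeneous_colon_eq {J p : Ideal S}
    (hJ : J.IsHomogeneous (homogeneousSubmodule (Fin n) K)) (hp : p ∈ J.associatedPrimes) :
    ∃ d, ∃ f ∈ homogeneousSubmodule (Fin n) K d, J.colon {f} = p := by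
  have hph := isHomogeneous_of_mem_associatedPrimes hJ hp
  obtain ⟨hp, f, hf⟩ := Submodule.isAssociatedPrime_iff.1 hp
  by_contra! hcon
  refine notMem_saturation hp hf.symm (mem_of_homogeneousComponent_mem _ fun i => ?_)
  exact mem_saturation_of_colon_ne hp
    (homogeneousComponent_mem_of_mem (isHomogeneous_colon hJ hph)
      (mem_colon_of_colon_singleton_eq hf.symm) i)
    (hcon i _ (homogeneousComponent_mem i f))

theorem degree_pos_of_mem {I : Ideal S} (hI : I ≠ ⊤) {g : S} (hg : g ∈ I) (hg0 : g ≠ 0) {i : ℕ}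
    (hi : g.IsHomogeneous i) : 0 < i := by
  rcases Nat.eq_zero_or_pos i with rfl | h
  · rw [← totalDegree_zero_iff_isHomogeneous, totalDegree_eq_zero_iff_eq_C] at hi
    refine absurd (Ideal.eq_top_of_isUnit_mem _ hg ?_) hI
    rw [hi]
    refine IsUnit.map C (isUnit_iff_ne_zero.2 fun h => hg0 ?_)
    rw [hi, h, C_0]
  · exact h

theorem exists_lt_colon_eq {I p : Ideal S} (hI : I.IsHomogeneous (homogeneousSubmodule (Fin n) K))
    (hI1 : I ≠ ⊤) (hp : p.IsPrime) (hph : p.IsHomogeneous (homogeneousSubmodule (Fin n) K)) {k : ℕ}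
    (hk : (I ^ (k + 1)).colon (p : Set S) = I * (I ^ k).colon (p : Set S)) {d : ℕ} {f : S}
    (hfd : f ∈ homogeneousSubmodule (Fin n) K d) (hf : (I ^ (k + 1)).colon {f} = p) :
    ∃ e < d, ∃ g ∈ homogeneousSubmodule (Fin n) K e, (I ^ k).colon {g} = p := by
  by_contra! hcon
  have hmem := mem_colon_of_colon_singleton_eq hf
  rw [hk] at hmem
  refine notMem_saturation hp hf (mem_of_mem_mul_of_isHomogeneous hI
    (isHomogeneous_colon (isHomogeneous_pow hI k) hph) _ ?_ hmem hfd)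
  intro i j hij g hg hgi h hh hhj
  by_cases hg0 : g = 0
  · rw [hg0, zero_mul]
    exact AddSubmonoid.zero_mem _
  -- Positivity of `i` gives `j < d`, which makes the descent strict.
  have hi := degree_pos_of_mem hI1 hg hg0 hgi
  obtain ⟨a, ha, hah⟩ := mem_saturation_of_colon_ne hp hh (hcon j (by omega) h hhj)
  refine ⟨a, ha, ?_⟩
  rw [mul_left_comm, pow_succ']
  exact Ideal.mul_mem_mul hg hah

theorem vNumberAt_lt_vNumberAt {I p : Ideal S}
    (hI : I.IsHomogeneous (homogeneousSubmodule (Fin n) K)) (hI1 : I ≠ ⊤) {k : ℕ}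
    (hk : (I ^ (k + 1)).colon (p : Set S) = I * (I ^ k).colon (p : Set S))
    (hp : p ∈ (I ^ (k + 1)).associatedPrimes) :
    vNumberAt p (I ^ k) < vNumberAt p (I ^ (k + 1)) := by
  have hph := isHomogeneous_of_mem_associatedPrimes (isHomogeneous_pow hI _) hp
  obtain ⟨f, hfd, hf⟩ := Nat.sInf_mem
    (exists_isHomogeneous_colon_eq (isHomogeneous_pow hI _) hp)
  obtain ⟨e, he, g, hg⟩ := exists_lt_colon_eq hI hI1 hp.1 hph hk hfd hf
  refine lt_of_le_of_lt (Nat.sInf_le ?_) he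
  exact ⟨g, hg⟩

theorem vNumber_lt_vNumber {I : Ideal S}
    (hI : I.IsHomogeneous (homogeneousSubmodule (Fin n) K)) (hI1 : I ≠ ⊤) {k : ℕ}
    (hk : ∀ p ∈ (I ^ (k + 1)).associatedPrimes,
      (I ^ (k + 1)).colon (p : Set S) = I * (I ^ k).colon (p : Set S)) :
    vNumber (I ^ k) < vNumber (I ^ (k + 1)) := by
  -- Nonemptiness ensures that the infimum is attained rather than the default `0`.
  have hne : {d | ∃ f ∈ homogeneousSubmodule (Fin n) K d,
      (I ^ (k + 1)).colon {f} ∈ (I ^ (k + 1)).associatedPrimes}.Nonempty := by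
    have : Nontrivial (S ⧸ I ^ (k + 1)) := Ideal.Quotient.nontrivial_iff.2 fun h =>
      hI1 (top_le_iff.1 (h ▸ Ideal.pow_le_self k.succ_ne_zero))
    obtain ⟨p, hp⟩ := associatedPrimes.nonempty S (S ⧸ I ^ (k + 1))
    obtain ⟨hp, x, hx⟩ := isAssociatedPrime_iff.1 hp
    obtain ⟨x, rfl⟩ := Submodule.Quotient.mk_surjective _ x
    have hp' : p ∈ (I ^ (k + 1)).associatedPrimes := by
      refine Submodule.isAssociatedPrime_iff.2 ⟨hp, x, hx.trans ?_⟩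
      ext r
      rw [Submodule.mem_colon_singleton, Submodule.mem_colon_singleton, Submodule.mem_bot,
        ← Submodule.Quotient.mk_smul, Submodule.Quotient.mk_eq_zero]
    obtain ⟨d, f, hfd, hf⟩ := exists_isHomogeneous_colon_eq (isHomogeneous_pow hI _) hp'
    exact ⟨d, f, hfd, hf ▸ hp'⟩
  obtain ⟨f, hfd, hf⟩ := Nat.sInf_mem hne
  have hph := isHomogeneous_of_mem_associatedPrimes (isHomogeneous_pow hI _) hf
  obtain ⟨e, he, g, hgd, hg⟩ := exists_lt_colon_eq hI hI1 hf.1 hph (hk _ hf) hfd rfl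
  refine lt_of_le_of_lt (Nat.sInf_le ?_) he
  refine ⟨g, hgd, ?_⟩
  rw [hg]
  exact Submodule.isAssociatedPrime_iff.2 ⟨hf.1, g, hg.symm⟩

-- Initial and generator degrees in terms of polynomials.

local notation "𝔪" => (Ideal.span (Set.range X) : Ideal (MvPolynomial (Fin n) K))

theorem map_restrictScalars_ne_bot_iff {M N : Type*} [AddCommGroup M] [Module K M]
    [Module S M] [IsScalarTower K S M] [AddCommGroup N] [Module K N] [Module S N]
    [IsScalarTower K S N] (φ : M →ₗ[S] N) (A : Submodule K M) :
    A.map (φ.restrictScalars K) ≠ ⊥ ↔ ∃ x ∈ A, φ x ≠ 0 := by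
  rw [Submodule.ne_bot_iff]
  constructor
  · rintro ⟨_, ⟨x, hx, rfl⟩, h⟩
    exact ⟨x, hx, h⟩
  · rintro ⟨x, hx, h⟩
    exact ⟨_, ⟨x, hx, rfl⟩, h⟩

theorem idealPiece_ne_bot_iff (I : Ideal S) (d : ℕ) :
    idealPiece I d ≠ ⊥ ↔ ∃ f ∈ I, f.IsHomogeneous d ∧ f ≠ 0 := by
  rw [Submodule.ne_bot_iff]
  constructor
  · rintro ⟨⟨f, hf⟩, hd, h⟩
    exact ⟨f, hf, hd, fun h' => h (Subtype.ext h')⟩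
  · rintro ⟨f, hf, hd, h⟩
    exact ⟨⟨f, hf⟩, hd, fun h' => h (congrArg Subtype.val h')⟩

theorem colonQuotientPiece_ne_bot_iff (J p : Ideal S) (d : ℕ) :
    colonQuotientPiece J p d ≠ ⊥ ↔
      ∃ f ∈ J.colon (p : Set S), f.IsHomogeneous d ∧ f ∉ J := by
  rw [colonQuotientPiece, map_restrictScalars_ne_bot_iff]
  constructor
  · rintro ⟨⟨f, hf⟩, hd, h⟩
    refine ⟨f, hf, hd, fun h' => h ?_⟩
    rw [Submodule.mkQ_apply, Submodule.Quotient.mk_eq_zero]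
    exact h'
  · rintro ⟨f, hf, hd, h⟩
    refine ⟨⟨f, hf⟩, hd, fun h' => h ?_⟩
    rw [Submodule.mkQ_apply, Submodule.Quotient.mk_eq_zero] at h'
    exact h'

theorem mem_smul_top_quotient_iff {R : Type*} [CommRing R] (J N m : Ideal R) (hJ : J ≤ N) (x : N) :
    (Submodule.Quotient.mk x : N ⧸ J.submoduleOf N) ∈ m • (⊤ : Submodule R (N ⧸ J.submoduleOf N)) ↔
      (x : R) ∈ J ⊔ m * N := by
  have h : m • (⊤ : Submodule R (N ⧸ J.submoduleOf N)) =
      (m • (⊤ : Submodule R N)).map (J.submoduleOf N).mkQ := by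
    rw [Submodule.map_smul'', Submodule.map_top, Submodule.range_mkQ]
  rw [h, ← Submodule.mkQ_apply, ← Submodule.mem_comap, Submodule.comap_map_mkQ]
  constructor
  · intro hx
    obtain ⟨a, ha, b, hb, rfl⟩ := Submodule.mem_sup.1 hx
    exact Submodule.add_mem_sup ha ((Submodule.mem_smul_top_iff _ _ _).1 hb)
  · intro hx
    obtain ⟨a, ha, b, hb, hab⟩ := Submodule.mem_sup.1 hx
    have hbN : b ∈ N := (Ideal.mul_le_right : m * N ≤ N) hb
    refine Submodule.mem_sup.2 ⟨⟨a, hJ ha⟩, ha, ⟨b, hbN⟩, ?_, Subtype.ext hab⟩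
    exact (Submodule.mem_smul_top_iff _ _ _).2 hb

theorem colonQuotient_generator_iff (J p : Ideal S) (d : ℕ) :
    (colonQuotientPiece J p d).map ((Submodule.mkQ (𝔪 •
      (⊤ : Submodule S (ColonQuotient J p)))).restrictScalars K) ≠ ⊥ ↔
    ∃ f ∈ J.colon (p : Set S), f.IsHomogeneous d ∧ f ∉ J ⊔ 𝔪 * J.colon (p : Set S) := by
  rw [map_restrictScalars_ne_bot_iff]
  constructor
  · rintro ⟨_, ⟨⟨f, hf⟩, hd, rfl⟩, h⟩
    refine ⟨f, hf, hd, fun h' => h ?_⟩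
    rw [Submodule.mkQ_apply, Submodule.Quotient.mk_eq_zero]
    exact (mem_smul_top_quotient_iff J _ 𝔪 Ideal.le_colon ⟨f, hf⟩).2 h'
  · rintro ⟨f, hf, hd, h⟩
    refine ⟨_, ⟨⟨f, hf⟩, hd, rfl⟩, fun h' => h ?_⟩
    rw [Submodule.mkQ_apply, Submodule.Quotient.mk_eq_zero] at h'
    exact (mem_smul_top_quotient_iff J _ 𝔪 Ideal.le_colon ⟨f, hf⟩).1 h'

theorem ideal_generator_iff (I : Ideal S) (d : ℕ) :
    (idealPiece I d).map ((Submodule.mkQ (𝔪 • (⊤ : Submodule S I))).restrictScalars K) ≠ ⊥ ↔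
    ∃ f ∈ I, f.IsHomogeneous d ∧ f ∉ 𝔪 * I := by
  rw [map_restrictScalars_ne_bot_iff]
  constructor
  · rintro ⟨⟨f, hf⟩, hd, h⟩
    refine ⟨f, hf, hd, fun h' => h ?_⟩
    rw [Submodule.mkQ_apply, Submodule.Quotient.mk_eq_zero]
    exact (Submodule.mem_smul_top_iff _ _ _).2 h'
  · rintro ⟨f, hf, hd, h⟩
    refine ⟨⟨f, hf⟩, hd, fun h' => h ?_⟩
    rw [Submodule.mkQ_apply, Submodule.Quotient.mk_eq_zero] at h'
    exact (Submodule.mem_smul_top_iff _ _ _).1 h'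

theorem span_X_ne_top : 𝔪 ≠ ⊤ := by
  intro h
  have h1 : (1 : S) ∈ 𝔪 := h ▸ Submodule.mem_top
  have h2 : 𝔪 ≤ RingHom.ker (constantCoeff : S →+* K) := by
    rw [Ideal.span_le]
    rintro _ ⟨i, rfl⟩
    simp [RingHom.mem_ker]
  simpa [RingHom.mem_ker] using h2 h1

theorem isHomogeneous_span_X : (𝔪).IsHomogeneous (homogeneousSubmodule (Fin n) K) := by
  apply Ideal.homogeneous_span
  rintro _ ⟨i, rfl⟩
  exact ⟨1, isHomogeneous_X K i⟩

theorem mem_span_X_of_isHomogeneous {f : S} {d : ℕ} (hd : 0 < d) (hf : f.IsHomogeneous d) :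
    f ∈ 𝔪 := by
  rw [← Set.image_univ, mem_ideal_span_X_image]
  intro m hm
  by_contra! h
  have := hf (mem_support_iff.1 hm)
  have hm0 : m = 0 := by ext i; simpa using h i
  rw [hm0, map_zero] at this
  omega

/-! ### Graded Nakayama and boundedness of generator degrees. -/

/-- The homogeneous elements of `N` of degree at most `D`. -/
def lowDegree (N : Ideal S) (D : ℕ) : Set S :=
  {f | f ∈ N ∧ ∃ d ≤ D, f.IsHomogeneous d}

/-- Graded Nakayama modulo `N'`: induct on degree, since factors from `𝔪` have positive degree. -/
theorem le_sup_span_lowDegree {N N' : Ideal S}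
    (hN : N.IsHomogeneous (homogeneousSubmodule (Fin n) K))
    (hN' : N'.IsHomogeneous (homogeneousSubmodule (Fin n) K)) {D : ℕ}
    (h : ∀ d > D, ∀ f ∈ N, f.IsHomogeneous d → f ∈ N' ⊔ 𝔪 * N) :
    N ≤ N' ⊔ Ideal.span (lowDegree N D) := by
  have key : ∀ d, ∀ f ∈ N, f.IsHomogeneous d → f ∈ N' ⊔ Ideal.span (lowDegree N D) := by
    intro d
    induction d using Nat.strong_induction_on with
    | _ d ih =>
      intro f hf hfd
      rcases Nat.lt_or_ge D d with hd | hd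
      · obtain ⟨a, ha, b, hb, hab⟩ := Submodule.mem_sup.1 (h d hd f hf hfd)
        rw [← homogeneousComponent_eq_self hfd, ← hab, map_add]
        refine Ideal.add_mem _ (Submodule.mem_sup_left
          (homogeneousComponent_mem_of_mem hN' ha d)) ?_
        refine homogeneousComponent_mem_of_mem_mul isHomogeneous_span_X hN
          (N' ⊔ Ideal.span (lowDegree N D)).toAddSubmonoid d ?_ hb
        intro i j hij g hg hgi k hk hkj
        by_cases hg0 : g = 0
        · rw [hg0, zero_mul]; exact AddSubmonoid.zero_mem _
        have := degree_pos_of_mem span_X_ne_top hg hg0 hgi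
        exact Ideal.mul_mem_left _ _ (ih j (by omega) k hk hkj)
      · exact Submodule.mem_sup_right (Ideal.subset_span ⟨hf, d, hd, hfd⟩)
  intro f hf
  have : f ∈ (N' ⊔ Ideal.span (lowDegree N D)).toAddSubmonoid :=
    mem_of_homogeneousComponent_mem _ fun i =>
      key i _ (homogeneousComponent_mem_of_mem hN hf i) (homogeneousComponent_isHomogeneous i f)
  exact this

/-- The ideals generated in degrees at most `D` stabilize; beyond that degree the coefficients lie
in `𝔪`. This bounds the sets defining `ω`, whose `sSup` would otherwise default to `0`. -/
theorem exists_forall_mem_span_X_mul (N : Ideal S) :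
    ∃ D, ∀ d > D, ∀ f ∈ N, f.IsHomogeneous d → f ∈ 𝔪 * N := by
  have hmono : Monotone fun D => Ideal.span (lowDegree N D) := fun a b hab =>
    Ideal.span_mono fun f hf => ⟨hf.1, hf.2.imp fun d hd => ⟨hd.1.trans hab, hd.2⟩⟩
  obtain ⟨D, hD⟩ := monotone_stabilizes_iff_noetherian.2 (inferInstance : IsNoetherian S S)
    ⟨_, hmono⟩
  refine ⟨D, fun d hd f hf hfd => ?_⟩
  have hfD : f ∈ Ideal.span (lowDegree N D) := by
    have h1 : f ∈ Ideal.span (lowDegree N d) := Ideal.subset_span ⟨hf, d, le_rfl, hfd⟩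
    have h2 : Ideal.span (lowDegree N D) = Ideal.span (lowDegree N d) := hD d hd.le
    rwa [h2]
  rw [← homogeneousComponent_eq_self hfd]
  clear hf hfd
  induction hfD using Submodule.closure_induction with
  | zero => simp
  | add x y _ _ hx hy => rw [map_add]; exact Ideal.add_mem _ hx hy
  | smul_mem a x hx =>
    obtain ⟨hxN, j, hj, hxj⟩ := hx
    obtain ⟨i, rfl⟩ := Nat.exists_eq_add_of_le (show j ≤ d by omega)
    rw [smul_eq_mul, mul_comm a x, homogeneousComponent_mul_of_isHomogeneous hxj, mul_comm x]
    exact Ideal.mul_mem_mul (mem_span_X_of_isHomogeneous (by omega)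
      (homogeneousComponent_isHomogeneous i a)) hxN

theorem bddAbove_colonQuotient_generators (J p : Ideal S) :
    BddAbove {d | (colonQuotientPiece J p d).map ((Submodule.mkQ (𝔪 •
      (⊤ : Submodule S (ColonQuotient J p)))).restrictScalars K) ≠ ⊥} := by
  obtain ⟨D, hD⟩ := exists_forall_mem_span_X_mul (J.colon (p : Set S))
  refine ⟨D, fun d hd => ?_⟩
  obtain ⟨f, hf, hfd, hfJ⟩ := (colonQuotient_generator_iff J p d).1 hd
  by_contra! hlt
  exact hfJ (Submodule.mem_sup_right (hD d hlt f hf hfd))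

theorem bddAbove_ideal_generators (I : Ideal S) :
    BddAbove {d | (idealPiece I d).map
      ((Submodule.mkQ (𝔪 • (⊤ : Submodule S I))).restrictScalars K) ≠ ⊥} := by
  obtain ⟨D, hD⟩ := exists_forall_mem_span_X_mul I
  refine ⟨D, fun d hd => ?_⟩
  obtain ⟨f, hf, hfd, hfJ⟩ := (ideal_generator_iff I d).1 hd
  by_contra! hlt
  exact hfJ (hD d hlt f hf hfd)

theorem le_sup_span_lowDegree_omegaColon {J p : Ideal S}
    (hJ : J.IsHomogeneous (homogeneousSubmodule (Fin n) K))
    (h : (J.colon (p : Set S)).IsHomogeneous (homogeneousSubmodule (Fin n) K)) :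
    J.colon (p : Set S) ≤ J ⊔ Ideal.span (lowDegree (J.colon (p : Set S)) (omegaColon J p)) := by
  refine le_sup_span_lowDegree h hJ fun d hd f hf hfd => ?_
  by_contra hcon
  exact not_lt_of_ge (le_csSup (bddAbove_colonQuotient_generators J p)
    ((colonQuotient_generator_iff J p d).2 ⟨f, hf, hfd, hcon⟩)) hd

theorem le_span_lowDegree_omegaIdeal {I : Ideal S}
    (h : I.IsHomogeneous (homogeneousSubmodule (Fin n) K)) :
    I ≤ Ideal.span (lowDegree I (omegaIdeal I)) := by
  have := le_sup_span_lowDegree (D := omegaIdeal I) h (Ideal.IsHomogeneous.bot _)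
    fun d hd f hf hfd => by
      by_contra hcon
      rw [bot_sup_eq] at hcon
      exact not_lt_of_ge (le_csSup (bddAbove_ideal_generators I)
        ((ideal_generator_iff I d).2 ⟨f, hf, hfd, hcon⟩)) hd
  rwa [bot_sup_eq] at this

/-! ### The inequalities between `α` and `ω`. -/

theorem alphaIdeal_le {I : Ideal S} {d : ℕ} {f : S} (hf : f ∈ I) (hd : f.IsHomogeneous d)
    (h0 : f ≠ 0) : alphaIdeal I ≤ d :=
  Nat.sInf_le ((idealPiece_ne_bot_iff I d).2 ⟨f, hf, hd, h0⟩)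

theorem alphaColon_le {J p : Ideal S} {d : ℕ} {f : S} (hf : f ∈ J.colon (p : Set S))
    (hd : f.IsHomogeneous d) (hJ : f ∉ J) : alphaColon J p ≤ d :=
  Nat.sInf_le ((colonQuotientPiece_ne_bot_iff J p d).2 ⟨f, hf, hd, hJ⟩)

theorem exists_isHomogeneous_alphaColon {J p : Ideal S}
    (h : (J.colon (p : Set S)).IsHomogeneous (homogeneousSubmodule (Fin n) K))
    (hlt : ¬ J.colon (p : Set S) ≤ J) :
    ∃ f ∈ J.colon (p : Set S), f.IsHomogeneous (alphaColon J p) ∧ f ∉ J := by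
  refine (colonQuotientPiece_ne_bot_iff J p _).1
    (Nat.sInf_mem (s := {d | colonQuotientPiece J p d ≠ ⊥}) ?_)
  by_contra hcon
  refine hlt fun f hf => ?_
  have : f ∈ J.toAddSubmonoid := mem_of_homogeneousComponent_mem _ fun i => by
    by_contra hfi
    exact hcon ⟨i, (colonQuotientPiece_ne_bot_iff J p i).2
      ⟨_, homogeneousComponent_mem_of_mem h hf i, homogeneousComponent_isHomogeneous i f, hfi⟩⟩
  exact this

/-- A nonzero class of least degree cannot lie in `𝔪` times the module, so it is a minimal
generator. -/
theorem alphaColon_le_omegaColon {J p : Ideal S}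
    (hJ : J.IsHomogeneous (homogeneousSubmodule (Fin n) K))
    (h : (J.colon (p : Set S)).IsHomogeneous (homogeneousSubmodule (Fin n) K))
    (hlt : ¬ J.colon (p : Set S) ≤ J) : alphaColon J p ≤ omegaColon J p := by
  obtain ⟨f, hf, hfd, hfJ⟩ := exists_isHomogeneous_alphaColon h hlt
  refine le_csSup (bddAbove_colonQuotient_generators J p)
    ((colonQuotient_generator_iff J p _).2 ⟨f, hf, hfd, fun hcon => hfJ ?_⟩)
  obtain ⟨a, ha, b, hb, hab⟩ := Submodule.mem_sup.1 hcon
  rw [← homogeneousComponent_eq_self hfd, ← hab, map_add]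
  refine J.add_mem (homogeneousComponent_mem_of_mem hJ ha _) ?_
  refine homogeneousComponent_mem_of_mem_mul isHomogeneous_span_X h J.toAddSubmonoid _ ?_ hb
  intro i j hij g hg hgi k hk hkj
  by_cases hg0 : g = 0
  · rw [hg0, zero_mul]; exact AddSubmonoid.zero_mem _
  have := degree_pos_of_mem span_X_ne_top hg hg0 hgi
  by_contra hgk
  have := alphaColon_le hk hkj fun hkJ => hgk (J.mul_mem_left g hkJ)
  omega

/-- Some product `g * h` in `f` is outside `I^(k+1)`, forcing `g ≠ 0` and `h ∉ I^k`. With `α ≤ ω`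
this yields the second claim. -/
theorem alphaColon_add_alphaIdeal_le {I p : Ideal S}
    (hI : I.IsHomogeneous (homogeneousSubmodule (Fin n) K))
    (hp : p.IsHomogeneous (homogeneousSubmodule (Fin n) K)) {k : ℕ}
    (hk : (I ^ (k + 1)).colon (p : Set S) = I * (I ^ k).colon (p : Set S))
    (hlt : ¬ (I ^ (k + 1)).colon (p : Set S) ≤ I ^ (k + 1)) :
    alphaColon (I ^ k) p + alphaIdeal I ≤ alphaColon (I ^ (k + 1)) p := by
  obtain ⟨f, hf, hfd, hfJ⟩ := exists_isHomogeneous_alphaColon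
    (isHomogeneous_colon (isHomogeneous_pow hI _) hp) hlt
  rw [hk] at hf
  by_contra! hcon
  refine hfJ (mem_of_mem_mul_of_isHomogeneous hI (isHomogeneous_colon (isHomogeneous_pow hI k) hp)
    (I ^ (k + 1)).toAddSubmonoid ?_ hf hfd)
  intro i j hij g hg hgi h hh hhj
  by_contra hgh
  have h1 := alphaIdeal_le hg hgi fun h0 => hgh (by
    rw [h0, zero_mul]; exact AddSubmonoid.zero_mem _)
  have h2 := alphaColon_le hh hhj fun hJ => hgh (by
    change g * h ∈ I ^ (k + 1)
    rw [pow_succ']; exact Ideal.mul_mem_mul hg hJ)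
  omega

/-- Otherwise all products of low-degree generators have degree below `α`, hence lie in `I^(k+1)`,
and the quotient vanishes. -/
theorem alphaColon_le_omegaColon_add_omegaIdeal {I p : Ideal S}
    (hI : I.IsHomogeneous (homogeneousSubmodule (Fin n) K))
    (hp : p.IsHomogeneous (homogeneousSubmodule (Fin n) K)) {k : ℕ}
    (hk : (I ^ (k + 1)).colon (p : Set S) = I * (I ^ k).colon (p : Set S))
    (hlt : ¬ (I ^ (k + 1)).colon (p : Set S) ≤ I ^ (k + 1)) :
    alphaColon (I ^ (k + 1)) p ≤ omegaColon (I ^ k) p + omegaIdeal I := by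
  by_contra! hcon
  apply hlt
  have hN := isHomogeneous_colon (isHomogeneous_pow hI k) hp
  have h1 : I * Ideal.span (lowDegree ((I ^ k).colon (p : Set S)) (omegaColon (I ^ k) p)) ≤
      I ^ (k + 1) := by
    refine (Ideal.mul_mono_left (le_span_lowDegree_omegaIdeal hI)).trans ?_
    rw [Ideal.span_mul_span', Ideal.span_le]
    rintro _ ⟨g, ⟨hg, i, hi, hgi⟩, h, ⟨hh, j, hj, hhj⟩, rfl⟩
    by_contra hgh
    have := alphaColon_le (J := I ^ (k + 1)) (p := p) (hk ▸ Ideal.mul_mem_mul hg hh)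
      (hgi.mul hhj) hgh
    omega
  calc (I ^ (k + 1)).colon (p : Set S) = I * (I ^ k).colon (p : Set S) := hk
    _ ≤ I * (I ^ k ⊔ Ideal.span (lowDegree ((I ^ k).colon (p : Set S)) (omegaColon (I ^ k) p))) :=
      Ideal.mul_mono_right (le_sup_span_lowDegree_omegaColon (isHomogeneous_pow hI k) hN)
    _ ≤ I ^ (k + 1) := by
      rw [Ideal.mul_sup, ← pow_succ']
      exact sup_le le_rfl h1

theorem not_colon_le_of_mem_associatedPrimes {J p : Ideal S} (hp : p ∈ J.associatedPrimes) :
    ¬ J.colon (p : Set S) ≤ J := by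
  obtain ⟨hp, f, hf⟩ := Submodule.isAssociatedPrime_iff.1 hp
  intro h
  refine hp.ne_top ((Ideal.eq_top_iff_one p).2 ?_)
  rw [hf, Submodule.mem_colon_singleton, one_smul]
  exact h (mem_colon_of_colon_singleton_eq hf.symm)

theorem ne_bot_of_mem_associatedPrimes_pow {I p : Ideal S} (hI : I ≠ ⊥) {k : ℕ}
    (hp : p ∈ (I ^ k).associatedPrimes) : p ≠ ⊥ := by
  obtain ⟨hp, f, hf⟩ := Submodule.isAssociatedPrime_iff.1 hp
  rintro rfl
  exact hI (le_bot_iff.1 (hp.le_of_pow_le (n := k) (hf ▸ Ideal.le_colon)))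

end VNumber

open VNumber in
theorem corollary3p3 {K : Type*} [Field K] {n : ℕ} (I : Ideal (MvPolynomial (Fin n) K))
    (hI : I.IsHomogeneous (homogeneousSubmodule (Fin n) K)) (hI0 : I ≠ ⊥) (hI1 : I ≠ ⊤) :
    (∃ k₀ : ℕ, StrictMonoOn (fun k : ℕ => VNumber.vNumber (I ^ k)) (Set.Ici k₀)) ∧
    ∀ p ∈ VNumber.stablePrimes I,
      (∃ k₀ : ℕ, StrictMonoOn (fun k : ℕ => VNumber.vNumberAt p (I ^ k)) (Set.Ici k₀)) ∧
      (∀ᶠ k : ℕ in atTop, VNumber.alphaColon (I ^ (k - 1)) p + VNumber.alphaIdeal I ≤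
        VNumber.omegaColon (I ^ k) p) ∧
      (∀ᶠ k : ℕ in atTop, VNumber.alphaColon (I ^ k) p ≤
        VNumber.omegaColon (I ^ (k - 1)) p + VNumber.omegaIdeal I) := by
  refine ⟨?_, fun p hp => ?_⟩
  · obtain ⟨s, hs, k₁, hk₁⟩ := Ideal.exists_finite_associatedPrimes_pow I hI0
    -- Finiteness of `s` makes one threshold serve all primes.
    have hev : ∀ᶠ k in atTop, ∀ p ∈ s, p ≠ ⊥ →
        (I ^ (k + 1)).colon (p : Set (MvPolynomial (Fin n) K)) =
          I * (I ^ k).colon (p : Set (MvPolynomial (Fin n) K)) := by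
      rw [hs.eventually_all]
      intro p _
      by_cases hp : p = ⊥
      · simp [hp]
      · obtain ⟨k₀, h⟩ := Ideal.exists_colon_pow_succ_eq I p hp
        exact eventually_atTop.2 ⟨k₀, fun k hk _ => h k hk⟩
    obtain ⟨k₀, hk₀⟩ := eventually_atTop.1 hev
    refine ⟨max k₀ k₁, strictMonoOn_of_lt_add_one Set.ordConnected_Ici fun k _ hk _ => ?_⟩
    exact vNumber_lt_vNumber hI hI1 fun p hp => hk₀ k (le_of_max_le_left hk) p
      (hk₁ (k + 1) ((le_of_max_le_right hk).trans k.le_succ) hp)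
      (ne_bot_of_mem_associatedPrimes_pow hI0 hp)
  · obtain ⟨k₁, hk₁⟩ := eventually_atTop.1 (show ∀ᶠ k : ℕ in atTop, p ∈ (I ^ k).associatedPrimes
      from hp)
    obtain ⟨k₀, hk₀⟩ := Ideal.exists_colon_pow_succ_eq I p
      (ne_bot_of_mem_associatedPrimes_pow hI0 (hk₁ k₁ le_rfl))
    have hph := isHomogeneous_of_mem_associatedPrimes (isHomogeneous_pow hI _) (hk₁ k₁ le_rfl)
    refine ⟨⟨max k₀ k₁, strictMonoOn_of_lt_add_one Set.ordConnected_Ici fun k _ hk _ => ?_⟩,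
      -- The extra `1` keeps `k - 1` above both thresholds and its subtraction untruncated.
      eventually_atTop.2 ⟨max k₀ k₁ + 1, fun k hk => ?_⟩,
      eventually_atTop.2 ⟨max k₀ k₁ + 1, fun k hk => ?_⟩⟩
    · exact vNumberAt_lt_vNumberAt hI hI1 (hk₀ k (le_of_max_le_left hk))
        (hk₁ (k + 1) ((le_of_max_le_right hk).trans k.le_succ))
    · obtain ⟨k, rfl⟩ : ∃ j, k = j + 1 := ⟨k - 1, by omega⟩
      have hlt := not_colon_le_of_mem_associatedPrimes (hk₁ (k + 1) (by omega))
      exact (alphaColon_add_alphaIdeal_le hI hph (hk₀ k (by omega)) hlt).trans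
        (alphaColon_le_omegaColon (isHomogeneous_pow hI _)
          (isHomogeneous_colon (isHomogeneous_pow hI _) hph) hlt)
    · obtain ⟨k, rfl⟩ : ∃ j, k = j + 1 := ⟨k - 1, by omega⟩
      exact alphaColon_le_omegaColon_add_omegaIdeal hI hph (hk₀ k (by omega))
        (not_colon_le_of_mem_associatedPrimes (hk₁ (k + 1) (by omega)))
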